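/- All graphs are finite and simple. A separation of a graph $G$ is a triple $(Y,S,Z)$ of (possibly empty) pairwise disjoint sets with $Y\cup S\cup Z=V(G)$ such that $G$ has no edge between $Y$ and $Z$; its order is $|S|$, and it is proper if $Y\neq\emptyset\neq Z$. Let $\mathrm{Sep}_{<k}(G)$ be the set of separations of order less than $k$. $G$ is $3$-connected if $|V(G)|>3$ and $G$ has no proper separation of order $2$. For $X\subseteq V(G)$, the torso $\mathrm{torso}(G,X)$ is obtained from the induced subgraph $G[X]$ by adding all edges $vw$ with $v\ne w$ in $X$ for which some connected component $C$ of $G\setminus X$ has $v,w\in N(C)$, where $N(C)$ is the set of vertices outside $C$ with a neighbour in $C$. A $G$-tangle of order $k$ is a set $\mathcal T\subseteq \mathrm{Sep}_{<k}(G)$ such that: (1) for every $(Y,S,Z)\in\mathrm{Sep}_{<k}(G)$, $(Y,S,Z)\in\mathcal T$ or $(Z,S,Y)\in\mathcal T$; (2) for all $(Y_i,S_i,Z_i)\in\mathcal T$, $i=1,2,3$, either $Z_1\cap Z_2\cap Z_3\ne\emptyset$ or some edge of $G$ has an endvertex in each $Z_i$; (3) $Z\ne\emptyset$ for all $(Y,S,Z)\in\mathcal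 T$. Order separations by letting $(Y,S,Z)\preceq(Y',S',Z')$ if $S\cup Z\subsetneq S'\cup Z'$, or $S\cup Z=S'\cup Z'$ and $S\subseteq S'$. Call $(Y,S,Z)$ degenerate if it is proper, $|Y|=1$ and $S$ is an independent set. For a tangle $\mathcal T$ let $\mathcal T_{\mathrm{nd}}$ be the set of non-degenerate $\preceq$-minimal elements of $\mathcal T$. Two separations $(Y_1,S_1,Z_1),(Y_2,S_2,Z_2)$ cross if $(Y_1\cup S_1)\cap(Y_2\cup S_2)\not\subseteq S_1\cap S_2$. A non-degenerate crossedge of $\mathcal T$ is an edge $s_1s_2$ of $G$ such that for two crossing separations $(Y_1,S_1,Z_1),(Y_2,S_2,Z_2)\in\mathcal T_{\mathrm{nd}}$ we have $S_1\cap Y_2=\{s_1\}$ and $S_2\cap Y_1=\{s_2\}$. Put $$R^{(0)}_{\mathcal T}=\bigcap_{(Y,S,Z)\in\mathcal T_{\mathrm{nd}}}Z\ \cup\bigcup_{(Y,S,Z)\in\mathcal T_{\mathrm{nd}}}S$$ (the intersection being $V(G)$ if $\mathcal T_{\mathrm{nd}}=\emptyset$). For a tangle $\mathcal T$ of order $4$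 of a $3$-connected graph, a region $R_{\mathcal T}$ is any set obtained from $R^{(0)}_{\mathcal T}$ by choosing one endvertex of each non-degenerate crossedge of $\mathcal T$ and deleting the chosen vertices. The graph $\mathrm{torso}(G,R_{\mathcal T})$ is the quasi-4-connected component of $G$ associated with $\mathcal T$. **Theorem.** Let $G,G'$ be $3$-connected graphs, and let $\mathcal T,\mathcal T'$ be tangles of order $4$ of $G$ and $G'$, respectively. Suppose that $f$ is an isomorphism from $G$ to $G'$ that maps $\mathcal T$ to $\mathcal T'$, that is, for all $(Y,S,Z)\in\mathrm{Sep}_{<4}(G)$ we have $(Y,S,Z)\in\mathcal T\iff(f(Y),f(S),f(Z))\in\mathcal T'$. Then for all regions $R_{\mathcal T}$ and $R_{\mathcal T'}$, whatever endvertices were chosen in forming them, the quasi-4-connected components $\mathrm{torso}(G,R_{\mathcal T})$ and $\mathrm{torso}(G',R_{\mathcal T'})$ are isomorphic. -/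

import Mathlib

namespace QuasiFour

variable {V W : Type*}

/-- A separation `(Y, S, Z)` of a graph: an ordered partition of the vertex set into three (possibly
empty) parts such that there is no edge between `Y` and `Z`. -/
@[ext]
structure Separation (G : SimpleGraph V) where
  Y : Set V
  S : Set V
  Z : Set V
  disjoint_YS : Disjoint Y S
  disjoint_YZ : Disjoint Y Z
  disjoint_SZ : Disjoint S Z
  cover : Y ∪ S ∪ Z = Set.univ
  not_adj : ∀ y ∈ Y, ∀ z ∈ Z, ¬ G.Adj y z

namespace Separation

variable {G : SimpleGraph V}

/-- The order of a separation. -/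
noncomputable def order (s : Separation G) : ℕ := s.S.ncard

/-- A separation is proper if both of its sides are nonempty. -/
def Proper (s : Separation G) : Prop := s.Y.Nonempty ∧ s.Z.Nonempty

/-- The separation `(Z, S, Y)`. -/
def swap (s : Separation G) : Separation G where
  Y := s.Z
  S := s.S
  Z := s.Y
  disjoint_YS := s.disjoint_SZ.symm
  disjoint_YZ := s.disjoint_YZ.symm
  disjoint_SZ := s.disjoint_YS.symm
  cover := by
    rw [← s.cover]
    ext v
    simp only [Set.mem_union]
    tauto
  not_adj := fun z hz y hy h => s.not_adj y hy z hz h.symm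

/-- The image `(f(Y), f(S), f(Z))` of a separation under a graph isomorphism. -/
def map {G' : SimpleGraph W} (f : G ≃g G') (s : Separation G) : Separation G' where
  Y := f '' s.Y
  S := f '' s.S
  Z := f '' s.Z
  disjoint_YS := (Set.disjoint_image_iff f.injective).2 s.disjoint_YS
  disjoint_YZ := (Set.disjoint_image_iff f.injective).2 s.disjoint_YZ
  disjoint_SZ := (Set.disjoint_image_iff f.injective).2 s.disjoint_SZ
  cover := by
    rw [← Set.image_union, ← Set.image_union, s.cover, Set.image_univ]
    exact f.surjective.range_eq
  not_adj := by
    rintro _ ⟨y, hy, rfl⟩ _ ⟨z, hz, rfl⟩ h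
    exact s.not_adj y hy z hz (f.map_adj_iff.1 h)

theorem ext_of_union_eq {s t : Separation G} (h : s.S ∪ s.Z = t.S ∪ t.Z) (hS : s.S = t.S) :
    s = t := by
  have hZ : s.Z = t.Z := by
    ext v
    have h1 := Set.ext_iff.1 h v
    have h2 := Set.ext_iff.1 hS v
    have h3 := fun a => Set.disjoint_left.1 s.disjoint_SZ (show v ∈ _ from a)
    have h4 := fun a => Set.disjoint_left.1 t.disjoint_SZ (show v ∈ _ from a)
    simp only [Set.mem_union] at h1
    tauto
  have hY : s.Y = t.Y := by
    ext v
    have h2 := Set.ext_iff.1 hS v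
    have h1 := Set.ext_iff.1 hZ v
    have h3 := fun a => Set.disjoint_left.1 s.disjoint_YS (show v ∈ _ from a)
    have h4 := fun a => Set.disjoint_left.1 t.disjoint_YS (show v ∈ _ from a)
    have h5 := fun a => Set.disjoint_left.1 s.disjoint_YZ (show v ∈ _ from a)
    have h6 := fun a => Set.disjoint_left.1 t.disjoint_YZ (show v ∈ _ from a)
    have h7 : v ∈ s.Y ∪ s.S ∪ s.Z := s.cover ▸ Set.mem_univ v
    have h8 : v ∈ t.Y ∪ t.S ∪ t.Z := t.cover ▸ Set.mem_univ v
    simp only [Set.mem_union] at h7 h8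
    tauto
  exact Separation.ext hY hS hZ

/-- The partial order on separations: `(Y, S, Z) ≤ (Y', S', Z')` if `S ∪ Z` is a proper subset of
`S' ∪ Z'`, or `S ∪ Z = S' ∪ Z'` and `S ⊆ S'`. -/
instance : PartialOrder (Separation G) where
  le s t := s.S ∪ s.Z ⊂ t.S ∪ t.Z ∨ (s.S ∪ s.Z = t.S ∪ t.Z ∧ s.S ⊆ t.S)
  le_refl _ := Or.inr ⟨rfl, subset_rfl⟩
  le_trans s t u hst htu := by
    rcases hst with hst | ⟨hst, hst'⟩ <;> rcases htu with htu | ⟨htu, htu'⟩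
    · exact Or.inl (hst.trans htu)
    · exact Or.inl (htu ▸ hst)
    · exact Or.inl (hst ▸ htu)
    · exact Or.inr ⟨hst.trans htu, hst'.trans htu'⟩
  le_antisymm s t hst hts := by
    rcases hst with hst | ⟨hst, hst'⟩ <;> rcases hts with hts | ⟨hts, hts'⟩
    · exact absurd (hst.trans hts) (ssubset_irrefl _)
    · exact absurd (hts ▸ hst) (ssubset_irrefl _)
    · exact absurd (hst ▸ hts) (ssubset_irrefl _)
    · exact ext_of_union_eq hst (hst'.antisymm hts')

/-- A separation is degenerate if it is proper, `|Y| = 1`, and `S` is an independent set. -/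
def Degenerate (s : Separation G) : Prop := s.Proper ∧ s.Y.ncard = 1 ∧ G.IsIndepSet s.S

/-- Two separations are orthogonal if `(Y₁ ∪ S₁) ∩ (Y₂ ∪ S₂) ⊆ S₁ ∩ S₂`. -/
def Orthogonal (s t : Separation G) : Prop := (s.Y ∪ s.S) ∩ (t.Y ∪ t.S) ⊆ s.S ∩ t.S

/-- Two separations cross if they are not orthogonal. -/
def Cross (s t : Separation G) : Prop := ¬ Orthogonal s t

end Separation

/-- A graph is `k`-connected if it has more than `k` vertices and no proper separation of order
`k - 1`. -/
def IsKConnected (G : SimpleGraph V) (k : ℕ) : Prop :=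
  k < Nat.card V ∧ ∀ s : Separation G, s.order + 1 = k → ¬ s.Proper

/-- A `G`-tangle of order `k`. -/
structure IsTangle (G : SimpleGraph V) (k : ℕ) (T : Set (Separation G)) : Prop where
  order_lt : ∀ s ∈ T, s.order < k
  mem_or_swap_mem : ∀ s : Separation G, s.order < k → s ∈ T ∨ s.swap ∈ T
  inter_nonempty_or_edge : ∀ s₁ ∈ T, ∀ s₂ ∈ T, ∀ s₃ ∈ T,
    (s₁.Z ∩ s₂.Z ∩ s₃.Z).Nonempty ∨
      ∃ e ∈ G.edgeSet, (∃ v ∈ e, v ∈ s₁.Z) ∧ (∃ v ∈ e, v ∈ s₂.Z) ∧ (∃ v ∈ e, v ∈ s₃.Z)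
  nonempty_Z : ∀ s ∈ T, s.Z.Nonempty

section Region

variable {G : SimpleGraph V}

/-- The set of minimal elements of a tangle. -/
def minimalSeps (T : Set (Separation G)) : Set (Separation G) :=
  {s | Minimal (· ∈ T) s}

/-- The set of non-degenerate minimal separations of a tangle. -/
def nondegMinimalSeps (T : Set (Separation G)) : Set (Separation G) :=
  {s ∈ minimalSeps T | ¬ s.Degenerate}

/-- `IsCrossedge s t e`: the separations `s` and `t` cross, and `e = s₁s₂` is an edge of `G` such
that `S₁ ∩ Y₂ = {s₁}` and `S₂ ∩ Y₁ = {s₂}`. -/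
def IsCrossedge (s t : Separation G) (e : Sym2 V) : Prop :=
  s.Cross t ∧ e ∈ G.edgeSet ∧
    ∃ v w : V, e = s(v, w) ∧ s.S ∩ t.Y = {v} ∧ t.S ∩ s.Y = {w}

/-- The non-degenerate crossedges of a tangle, that is, the crossedges of pairs of non-degenerate
minimal separations. -/
def nondegCrossedges (T : Set (Separation G)) : Set (Sym2 V) :=
  {e | ∃ s ∈ nondegMinimalSeps T, ∃ t ∈ nondegMinimalSeps T, IsCrossedge s t e}

/-- The set `R⁽⁰⁾`: the intersection of the sets `Z` (the whole vertex set if there are none),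
together with all the separators `S`, over the non-degenerate minimal separations `(Y, S, Z)`. -/
def baseRegion (T : Set (Separation G)) : Set V :=
  (⋂ s ∈ nondegMinimalSeps T, s.Z) ∪ ⋃ s ∈ nondegMinimalSeps T, s.S

/-- `R` is a region `R_T` of the tangle `T`: it is obtained from the base region by choosing an
endvertex `d e` of every non-degenerate crossedge `e` and deleting the chosen vertices. -/
def IsTangleRegion (T : Set (Separation G)) (R : Set V) : Prop :=
  ∃ d : Sym2 V → V, (∀ e ∈ nondegCrossedges T, d e ∈ e) ∧
    R = baseRegion T \ d '' nondegCrossedges T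

theorem exists_isTangleRegion (T : Set (Separation G)) : ∃ R, IsTangleRegion T R :=
  ⟨_, fun e => (Quot.out e).1, fun e _ => Sym2.out_fst_mem e, rfl⟩

end Region

/-- The neighbourhood `N(A)` of a vertex set `A`: all vertices outside `A` that have a neighbour in
`A`. -/
def setNeighbors (G : SimpleGraph V) (A : Set V) : Set V :=
  {v | v ∉ A ∧ ∃ a ∈ A, G.Adj a v}

/-- The torso of a vertex set `X`: the graph on `X` obtained from the induced subgraph by adding an
edge between any two distinct vertices that both lie in `N(C)`, for some connected component `C` of
the graph obtained from `G` by deleting `X`. -/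
def torso (G : SimpleGraph V) (X : Set V) : SimpleGraph X where
  Adj u v := (u : V) ≠ v ∧ (G.Adj u v ∨ ∃ C : (G.induce Xᶜ).ConnectedComponent,
    (u : V) ∈ setNeighbors G (Subtype.val '' C.supp) ∧
    (v : V) ∈ setNeighbors G (Subtype.val '' C.supp))
  symm := ⟨fun _ _ h => ⟨h.1.symm, h.2.imp (fun h => h.symm) (fun ⟨C, hu, hv⟩ => ⟨C, hv, hu⟩)⟩⟩
  loopless := ⟨fun _ h => h.1 rfl⟩

end QuasiFour

namespace QuasiFour

variable {V W : Type*}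

namespace Separation

variable {G : SimpleGraph V}

theorem mem_Y_or_S_or_Z (s : Separation G) (v : V) : v ∈ s.Y ∨ v ∈ s.S ∨ v ∈ s.Z := by
  have h : v ∈ s.Y ∪ s.S ∪ s.Z := s.cover ▸ Set.mem_univ v
  simpa only [Set.mem_union, or_assoc] using h

theorem notMem_S_of_mem_Y (s : Separation G) {v : V} (h : v ∈ s.Y) : v ∉ s.S :=
  Set.disjoint_left.1 s.disjoint_YS h

theorem notMem_Z_of_mem_Y (s : Separation G) {v : V} (h : v ∈ s.Y) : v ∉ s.Z :=
  Set.disjoint_left.1 s.disjoint_YZ h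

theorem notMem_Z_of_mem_S (s : Separation G) {v : V} (h : v ∈ s.S) : v ∉ s.Z :=
  Set.disjoint_left.1 s.disjoint_SZ h

theorem mem_Y_or_S_of_adj (s : Separation G) {v w : V} (hv : v ∈ s.Y) (h : G.Adj v w) :
    w ∈ s.Y ∨ w ∈ s.S := by
  rcases s.mem_Y_or_S_or_Z w with hw | hw | hw
  · exact Or.inl hw
  · exact Or.inr hw
  · exact absurd h (s.not_adj v hv w hw)

theorem mem_S_union_Z_iff (s : Separation G) {v : V} : v ∈ s.S ∪ s.Z ↔ v ∉ s.Y := by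
  have := s.mem_Y_or_S_or_Z v
  have := @notMem_S_of_mem_Y _ _ s v
  have := @notMem_Z_of_mem_Y _ _ s v
  simp only [Set.mem_union]
  tauto

/-- The separation with sides `Y` and `Z`; all other vertices form the separator. -/
def ofSides (Y Z : Set V) (hd : Disjoint Y Z) (h : ∀ y ∈ Y, ∀ z ∈ Z, ¬ G.Adj y z) :
    Separation G where
  Y := Y
  S := (Y ∪ Z)ᶜ
  Z := Z
  disjoint_YS := Set.disjoint_left.2 fun _ hv hn => hn (Or.inl hv)
  disjoint_YZ := hd
  disjoint_SZ := Set.disjoint_left.2 fun _ hn hv => hn (Or.inr hv)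
  cover := by
    ext v
    simp only [Set.mem_union, Set.mem_compl_iff, Set.mem_univ, iff_true]
    tauto
  not_adj := h

/-- The corner separation with small side `Y₁ ∪ Y₂` and big side `Z₁ ∩ Z₂`. -/
def corner (s t : Separation G) : Separation G :=
  ofSides (s.Y ∪ t.Y) (s.Z ∩ t.Z)
    (Set.disjoint_left.2 fun _ hy hz =>
      hy.elim (fun h => s.notMem_Z_of_mem_Y h hz.1) (fun h => t.notMem_Z_of_mem_Y h hz.2))
    (fun y hy z hz =>
      hy.elim (fun h => s.not_adj y h z hz.1) (fun h => t.not_adj y h z hz.2))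

theorem ncard_S_eq [Finite V] (s t : Separation G) :
    s.S.ncard = (s.S ∩ t.S).ncard + (s.S ∩ t.Y).ncard + (s.S ∩ t.Z).ncard := by
  rw [← Set.ncard_union_eq, ← Set.ncard_union_eq]
  · congr 1
    ext v
    have := t.mem_Y_or_S_or_Z v
    simp only [Set.mem_union, Set.mem_inter_iff]
    tauto
  · exact Set.disjoint_left.2 fun v h1 h2 => h1.elim
      (fun h => t.notMem_Z_of_mem_S h.2 h2.2) (fun h => t.notMem_Z_of_mem_Y h.2 h2.2)
  · exact Set.disjoint_left.2 fun v h1 h2 => t.notMem_S_of_mem_Y h2.2 h1.2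

/-- Moving a vertex from `Y` to the separator. -/
theorem exists_move [Finite V] (s : Separation G) (hs : s.Proper) (h : 1 < s.Y.ncard) :
    ∃ t : Separation G, t.Proper ∧ t.order = s.order + 1 := by
  obtain ⟨y, hy, y', hy', hne⟩ := (Set.one_lt_ncard_iff_nontrivial).1 h
  refine ⟨ofSides (s.Y \ {y}) s.Z (s.disjoint_YZ.mono_left Set.sdiff_subset)
    (fun a ha => s.not_adj a ha.1), ⟨⟨y', hy', hne.symm⟩, hs.2⟩, ?_⟩
  have : ((s.Y \ {y}) ∪ s.Z)ᶜ = insert y s.S := by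
    ext v
    have h1 := s.mem_Y_or_S_or_Z v
    have h2 := @notMem_S_of_mem_Y _ _ s v
    have h3 := @notMem_Z_of_mem_Y _ _ s v
    have h4 := @notMem_Z_of_mem_S _ _ s v
    by_cases hv : v = y
    · subst hv; simp [h3 hy]
    · simp only [Set.mem_compl_iff, Set.mem_union, Set.mem_sdiff, Set.mem_singleton_iff,
        Set.mem_insert_iff, hv]
      tauto
  change ((s.Y \ {y}) ∪ s.Z)ᶜ.ncard = s.S.ncard + 1
  rw [this, Set.ncard_insert_of_notMem (s.notMem_S_of_mem_Y hy)]

end Separation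

variable {G : SimpleGraph V}

section Connectivity

variable [Finite V]

theorem IsKConnected.exists_order_succ (hG : IsKConnected G 3) (s : Separation G) (hs : s.Proper)
    (h : s.order ≤ 1) : ∃ t : Separation G, t.Proper ∧ t.order = s.order + 1 := by
  by_cases h1 : 1 < s.Y.ncard
  · exact s.exists_move hs h1
  by_cases h2 : 1 < s.Z.ncard
  · exact s.swap.exists_move ⟨hs.2, hs.1⟩ h2
  exfalso
  have h3 := hG.1
  rw [← Set.ncard_univ, ← s.cover] at h3
  have h4 := Set.ncard_union_le (s.Y ∪ s.S) s.Z
  have h5 := Set.ncard_union_le s.Y s.S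
  have h6 : s.S.ncard ≤ 1 := h
  omega

theorem IsKConnected.three_le_order (hG : IsKConnected G 3) (s : Separation G) (hs : s.Proper) :
    3 ≤ s.order := by
  have h2 : ∀ t : Separation G, t.Proper → t.order ≠ 2 := fun t ht h => hG.2 t (by omega) ht
  have h1 : ∀ t : Separation G, t.Proper → t.order ≠ 1 := fun t ht h => by
    obtain ⟨u, hu, hu'⟩ := hG.exists_order_succ t ht (by omega)
    exact h2 u hu (by omega)
  have h0 : s.order ≠ 0 := fun h => by
    obtain ⟨u, hu, hu'⟩ := hG.exists_order_succ s hs (by omega)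
    exact h1 u hu (by omega)
  have := h1 s hs
  have := h2 s hs
  omega

/-- In a 3-connected graph, a set `X` that separates a nonempty set `B` from another vertex has at
least three elements. -/
theorem IsKConnected.three_le_ncard (hG : IsKConnected G 3) {B X : Set V} (hB : B.Nonempty)
    (hBX : ∀ b ∈ B, ∀ w, G.Adj b w → w ∈ B ∨ w ∈ X) {z : V} (hzB : z ∉ B) (hzX : z ∉ X) :
    3 ≤ X.ncard := by
  have h := hG.three_le_order (Separation.ofSides B (B ∪ X)ᶜ
    (Set.disjoint_left.2 fun _ hv hn => hn (Or.inl hv))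
    (fun b hb w hw hbw => hw (hBX b hb w hbw))) ⟨hB, ⟨z, fun h => h.elim hzB hzX⟩⟩
  refine h.trans (Set.ncard_le_ncard (fun v hv => ?_) X.toFinite)
  by_contra hX
  refine hv ?_
  by_cases hvB : v ∈ B
  · exact Or.inl hvB
  · exact Or.inr fun h => h.elim hvB hX

end Connectivity

section Tangle

variable {T : Set (Separation G)}

theorem IsTangle.corner_mem (hT : IsTangle G 4 T) {s t : Separation G} (hs : s ∈ T) (ht : t ∈ T)
    (h : (s.corner t).order < 4) : s.corner t ∈ T := by
  refine (hT.mem_or_swap_mem _ h).resolve_right fun hc => ?_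
  rcases hT.inter_nonempty_or_edge _ hs _ ht _ hc with ⟨v, ⟨h1, h2⟩, h3⟩ | ⟨e, he, h1, h2, h3⟩
  · exact h3.elim (fun h => s.notMem_Z_of_mem_Y h h1) (fun h => t.notMem_Z_of_mem_Y h h2)
  · obtain ⟨v, hv, hvY⟩ := h3
    obtain ⟨w, rfl⟩ := Sym2.mem_iff_exists.1 hv
    have key : ∀ u : Separation G, v ∈ u.Y → ¬ ∃ x ∈ s(v, w), x ∈ u.Z := by
      rintro u hu ⟨x, hx, hxZ⟩
      rcases Sym2.mem_iff.1 hx with rfl | rfl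
      · exact u.notMem_Z_of_mem_Y hu hxZ
      · exact u.not_adj _ hu _ hxZ he
    exact hvY.elim (fun h => key s h h1) (fun h => key t h h2)

theorem IsTangle.eq_of_Y_eq_empty [Finite V] (hT : IsTangle G 4 T) {s t : Separation G}
    (hs : s ∈ minimalSeps T) (ht : t ∈ minimalSeps T) (h : s.Y = ∅) : s = t ∧ s.S = ∅ := by
  let e : Separation G := Separation.ofSides ∅ Set.univ (Set.empty_disjoint _) (by simp)
  have heS : e.S = ∅ := by simp [e, Separation.ofSides]
  have heU : e.S ∪ e.Z = Set.univ := by simp [e, Separation.ofSides]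
  have heT : e ∈ T := by
    refine (hT.mem_or_swap_mem e (by simp [Separation.order, heS])).resolve_right fun h => ?_
    exact Set.not_nonempty_empty (hT.nonempty_Z _ h)
  have hsU : s.S ∪ s.Z = Set.univ := by
    rw [← s.cover, h, Set.empty_union]
  have hle : e ≤ s := Or.inr ⟨heU.trans hsU.symm, by simp [heS]⟩
  have hse : s = e := le_antisymm (hs.2 heT hle) hle
  refine ⟨?_, hse ▸ heS⟩
  by_cases htU : t.S ∪ t.Z = Set.univ
  · have hle : e ≤ t := Or.inr ⟨heU.trans htU.symm, by simp [heS]⟩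
    exact hse.trans (le_antisymm hle (ht.2 heT hle))
  · have hle : t ≤ s := Or.inl (hsU ▸ Set.ssubset_univ_iff.2 htU)
    exact le_antisymm (hs.2 ht.1 hle) hle

theorem mem_nondegCrossedges_iff {v w : V} : s(v, w) ∈ nondegCrossedges T ↔
    ∃ s ∈ nondegMinimalSeps T, ∃ t ∈ nondegMinimalSeps T, s.Cross t ∧ G.Adj v w ∧
      s.S ∩ t.Y = {v} ∧ t.S ∩ s.Y = {w} := by
  constructor
  · rintro ⟨s, hs, t, ht, hc, he, a, b, hab, ha, hb⟩
    rcases Sym2.eq_iff.1 hab with ⟨rfl, rfl⟩ | ⟨rfl, rfl⟩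
    · exact ⟨s, hs, t, ht, hc, he, ha, hb⟩
    · refine ⟨t, ht, s, hs, fun h => hc ?_, he, hb, ha⟩
      rwa [Separation.Orthogonal, Set.inter_comm, Set.inter_comm s.S]
  · rintro ⟨s, hs, t, ht, hc, he, ha, hb⟩
    exact ⟨s, hs, t, ht, hc, he, v, w, rfl, ha, hb⟩

theorem adj_of_mem_nondegCrossedges {v w : V} (h : s(v, w) ∈ nondegCrossedges T) : G.Adj v w := by
  obtain ⟨_, _, _, _, _, h, _⟩ := mem_nondegCrossedges_iff.1 h
  exact h

theorem exists_seps_of_mem_nondegCrossedges {v w : V} (h : s(v, w) ∈ nondegCrossedges T) :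
    ∃ s ∈ nondegMinimalSeps T, ∃ t ∈ nondegMinimalSeps T,
      v ∈ s.S ∧ v ∈ t.Y ∧ w ∈ t.S ∧ w ∈ s.Y := by
  obtain ⟨s, hs, t, ht, -, -, h1, h2⟩ := mem_nondegCrossedges_iff.1 h
  have h1 : v ∈ s.S ∩ t.Y := by simp [h1]
  have h2 : w ∈ t.S ∩ s.Y := by simp [h2]
  exact ⟨s, hs, t, ht, h1.1, h1.2, h2.1, h2.2⟩

theorem mem_baseRegion_of_mem_S {s : Separation G} (hs : s ∈ nondegMinimalSeps T) {v : V}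
    (hv : v ∈ s.S) : v ∈ baseRegion T :=
  Or.inr (Set.mem_iUnion₂.2 ⟨s, hs, hv⟩)

variable [Finite V]

theorem IsTangle.exists_adj_of_mem_S (hG : IsKConnected G 3) (hT : IsTangle G 4 T)
    {s : Separation G} (hs : s ∈ T) (hY : s.Y.Nonempty) {a : V} (ha : a ∈ s.S) :
    ∃ y ∈ s.Y, G.Adj y a := by
  by_contra! hn
  obtain ⟨z, hz⟩ := hT.nonempty_Z s hs
  have h1 := hG.three_le_ncard (B := s.Y) (X := s.S \ {a}) hY (fun b hb w hw =>
    (s.mem_Y_or_S_of_adj hb hw).imp_right fun h => ⟨h, fun e => hn b hb (e ▸ hw)⟩)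
    (fun h => s.notMem_Z_of_mem_Y h hz) (fun h => s.notMem_Z_of_mem_S h.1 hz)
  have h2 := Set.ncard_sdiff_singleton_lt_of_mem ha s.S.toFinite
  have h3 : s.S.ncard < 4 := hT.order_lt s hs
  omega

/-- The separator of the corner of two distinct minimal separations is big. -/
theorem IsTangle.four_le_of_ne (hG : IsKConnected G 3) (hT : IsTangle G 4 T)
    {s t : Separation G} (hs : s ∈ minimalSeps T) (ht : t ∈ minimalSeps T) (hne : s ≠ t) :
    4 ≤ (s.corner t).order := by
  by_contra! hlt
  have hc := hT.corner_mem hs.1 ht.1 hlt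
  have hYs : s.Y.Nonempty := Set.nonempty_iff_ne_empty.2 fun h =>
    hne (hT.eq_of_Y_eq_empty hs ht h).1
  have hYt : t.Y.Nonempty := Set.nonempty_iff_ne_empty.2 fun h =>
    hne (hT.eq_of_Y_eq_empty ht hs h).1.symm
  have key : ∀ u : Separation G, u ∈ minimalSeps T → u.Y ⊆ (s.corner t).Y →
      (s.corner t).Y ⊆ u.Y := by
    intro u hu hsub v hv
    by_contra hvu
    have hlt : (s.corner t).S ∪ (s.corner t).Z ⊂ u.S ∪ u.Z := by
      refine ⟨fun x hx => ?_, fun h => ?_⟩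
      · rw [Separation.mem_S_union_Z_iff] at hx ⊢
        exact fun h => hx (hsub h)
      · exact (Separation.mem_S_union_Z_iff _).1 (h ((Separation.mem_S_union_Z_iff _).2 hvu)) hv
    rcases hu.2 hc (Or.inl hlt) with h | h
    · exact hlt.asymm h
    · exact hlt.ne h.1.symm
  have hst : s.Y = t.Y :=
    (Set.subset_union_left.trans (key t ht Set.subset_union_right)).antisymm
      (Set.subset_union_right.trans (key s hs Set.subset_union_left))
  have hSsub : ∀ u w : Separation G, u ∈ T → u.Y.Nonempty → u.Y = w.Y → u.S ⊆ w.S := by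
    intro u w hu hY h a ha
    obtain ⟨y, hy, hya⟩ := hT.exists_adj_of_mem_S hG hu hY ha
    exact (w.mem_Y_or_S_of_adj (h ▸ hy) hya).resolve_left
      fun h' => u.notMem_S_of_mem_Y (h ▸ h') ha
  refine hne (Separation.ext_of_union_eq ?_
    ((hSsub s t hs.1 hYs hst).antisymm (hSsub t s ht.1 hYt hst.symm)))
  ext v
  rw [Separation.mem_S_union_Z_iff, Separation.mem_S_union_Z_iff, hst]

theorem IsTangle.ncard_le_two (hG : IsKConnected G 3) (hT : IsTangle G 4 T)
    {s t : Separation G} (hs : s ∈ minimalSeps T) (ht : t ∈ minimalSeps T) (hne : s ≠ t) :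
    (s.S ∩ t.S).ncard + (s.S ∩ t.Y).ncard + (t.S ∩ s.Y).ncard ≤ 2 := by
  have h1 := hT.four_le_of_ne hG hs ht hne
  have h2 : (s.corner t).order ≤
      (s.S ∩ t.S).ncard + (s.S ∩ t.Z).ncard + (t.S ∩ s.Z).ncard := by
    refine le_trans (Set.ncard_le_ncard (t := s.S ∩ t.S ∪ s.S ∩ t.Z ∪ t.S ∩ s.Z) ?_
      (Set.toFinite _)) ((Set.ncard_union_le _ _).trans
        (Nat.add_le_add_right (Set.ncard_union_le _ _) _))
    intro v hv
    have h1 := s.mem_Y_or_S_or_Z v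
    have h2 := t.mem_Y_or_S_or_Z v
    have h3 : ¬ ((v ∈ s.Y ∨ v ∈ t.Y) ∨ (v ∈ s.Z ∧ v ∈ t.Z)) := hv
    simp only [Set.mem_union, Set.mem_inter_iff]
    tauto
  have h3 := s.ncard_S_eq t
  have h4 := t.ncard_S_eq s
  rw [Set.inter_comm t.S s.S] at h4
  have h5 : s.S.ncard < 4 := hT.order_lt s hs.1
  have h6 : t.S.ncard < 4 := hT.order_lt t ht.1
  omega

theorem IsTangle.disjoint_Y (hG : IsKConnected G 3) (hT : IsTangle G 4 T)
    {s t : Separation G} (hs : s ∈ minimalSeps T) (ht : t ∈ minimalSeps T) (hne : s ≠ t) :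
    Disjoint s.Y t.Y := by
  rw [Set.disjoint_iff_inter_eq_empty, ← Set.not_nonempty_iff_eq_empty]
  intro hB
  obtain ⟨z, hz⟩ := hT.nonempty_Z s hs.1
  have h1 := hG.three_le_ncard (B := s.Y ∩ t.Y) (X := s.S ∩ t.S ∪ s.S ∩ t.Y ∪ t.S ∩ s.Y) hB
    (fun b hb w hw => by
      have h1 := s.mem_Y_or_S_of_adj hb.1 hw
      have h2 := t.mem_Y_or_S_of_adj hb.2 hw
      simp only [Set.mem_union, Set.mem_inter_iff]
      tauto) (fun h => s.notMem_Z_of_mem_Y h.1 hz) (z := z) (by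
      have h1 := fun h => s.notMem_Z_of_mem_Y (v := z) h hz
      have h2 := fun h => s.notMem_Z_of_mem_S (v := z) h hz
      simp only [Set.mem_union, Set.mem_inter_iff]
      tauto)
  have h2 := hT.ncard_le_two hG hs ht hne
  have h3 := Set.ncard_union_le (s.S ∩ t.S ∪ s.S ∩ t.Y) (t.S ∩ s.Y)
  have h4 := Set.ncard_union_le (s.S ∩ t.S) (s.S ∩ t.Y)
  omega

/-- If the separator of a minimal separation meets the small side of another one, then the converse
holds as well. -/
theorem IsTangle.nonempty_inter (hG : IsKConnected G 3) (hT : IsTangle G 4 T)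
    {s t : Separation G} (hs : s ∈ minimalSeps T) (ht : t ∈ minimalSeps T) (hne : s ≠ t)
    (h : (s.S ∩ t.Y).Nonempty) : (t.S ∩ s.Y).Nonempty := by
  by_contra hn
  rw [Set.not_nonempty_iff_eq_empty] at hn
  have hYs : s.Y.Nonempty := Set.nonempty_iff_ne_empty.2 fun h =>
    hne (hT.eq_of_Y_eq_empty hs ht h).1
  have hd := Set.disjoint_left.1 (hT.disjoint_Y hG hs ht hne)
  have hsub : s.Y ⊆ t.Z := fun v hv =>
    ((t.mem_Y_or_S_or_Z v).resolve_left (hd hv)).resolve_left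
      fun h => Set.notMem_empty v (hn ▸ ⟨h, hv⟩)
  obtain ⟨a, ha, haY⟩ := h
  obtain ⟨y, hy, hya⟩ := hT.exists_adj_of_mem_S hG hs.1 hYs ha
  exact t.not_adj a haY y (hsub hy) hya.symm

/-- The structure of a crossing of two minimal separations. -/
theorem IsTangle.crossing (hG : IsKConnected G 3) (hT : IsTangle G 4 T)
    {s t : Separation G} (hs : s ∈ minimalSeps T) (ht : t ∈ minimalSeps T) {v : V}
    (hvs : v ∈ s.S) (hvt : v ∈ t.Y) :
    ∃ y, s.S ∩ t.Y = {v} ∧ t.S ∩ s.Y = {y} ∧ s.S ∩ t.S = ∅ ∧ G.Adj v y := by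
  have hne : s ≠ t := by
    rintro rfl
    exact s.notMem_S_of_mem_Y hvt hvs
  have h1 : (s.S ∩ t.Y).Nonempty := ⟨v, hvs, hvt⟩
  have h2 := hT.nonempty_inter hG hs ht hne h1
  have h3 := hT.ncard_le_two hG hs ht hne
  have h4 := h1.ncard_pos
  have h5 := h2.ncard_pos
  obtain ⟨x, hx⟩ := Set.ncard_eq_one.1 (show (s.S ∩ t.Y).ncard = 1 by omega)
  obtain ⟨y, hy⟩ := Set.ncard_eq_one.1 (show (t.S ∩ s.Y).ncard = 1 by omega)
  have h6 : s.S ∩ t.S = ∅ := (Set.ncard_eq_zero (Set.toFinite _)).1 (by omega)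
  obtain rfl : v = x := by simpa [hx] using (show v ∈ s.S ∩ t.Y from ⟨hvs, hvt⟩)
  have hy' : y ∈ t.S ∩ s.Y := by simp [hy]
  obtain ⟨b, hb, hbv⟩ := hT.exists_adj_of_mem_S hG hs.1 ⟨y, hy'.2⟩ hvs
  have hbt : b ∈ t.S := (t.mem_Y_or_S_of_adj hvt hbv.symm).resolve_left
    fun h => Set.disjoint_left.1 (hT.disjoint_Y hG hs ht hne) hb h
  obtain rfl : b = y := by simpa [hy] using (show b ∈ t.S ∩ s.Y from ⟨hbt, hb⟩)
  exact ⟨b, hx, hy, h6, hbv.symm⟩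

/-- A vertex of a separator that lies in the small side of another separation is the end of a
crossedge. -/
theorem IsTangle.exists_crossedge (hG : IsKConnected G 3) (hT : IsTangle G 4 T)
    {s t : Separation G} (hs : s ∈ nondegMinimalSeps T) (ht : t ∈ nondegMinimalSeps T) {v : V}
    (hvs : v ∈ s.S) (hvt : v ∈ t.Y) :
    ∃ y, y ∈ t.S ∧ y ∈ s.Y ∧ s(v, y) ∈ nondegCrossedges T ∧
      (∀ b ∈ s.Y, G.Adj v b → b = y) ∧ (∀ x ∈ s.S, x ≠ v → x ∈ t.Z) := by
  obtain ⟨y, h1, h2, h3, h4⟩ := hT.crossing hG hs.1 ht.1 hvs hvt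
  have hy : y ∈ t.S ∩ s.Y := by simp [h2]
  refine ⟨y, hy.1, hy.2, mem_nondegCrossedges_iff.2 ⟨s, hs, t, ht, fun h => ?_, h4, h1, h2⟩,
    fun b hb hvb => ?_, fun x hx hxv => ?_⟩
  · have := h (show v ∈ _ from ⟨Or.inr hvs, Or.inl hvt⟩)
    rw [h3] at this
    exact this
  · have hne : s ≠ t := by
      rintro rfl
      exact s.notMem_S_of_mem_Y hvt hvs
    have hbt := (t.mem_Y_or_S_of_adj hvt hvb).resolve_left
      fun h => Set.disjoint_left.1 (hT.disjoint_Y hG hs.1 ht.1 hne) hb h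
    simpa [h2] using (show b ∈ t.S ∩ s.Y from ⟨hbt, hb⟩)
  · rcases t.mem_Y_or_S_or_Z x with h | h | h
    · exact absurd (by simpa [h1] using (show x ∈ s.S ∩ t.Y from ⟨hx, h⟩)) hxv
    · exact absurd (show x ∈ s.S ∩ t.S from ⟨hx, h⟩) (by simp [h3])
    · exact h

/-- The non-degenerate crossedges form a matching. -/
theorem IsTangle.crossedge_unique (hG : IsKConnected G 3) (hT : IsTangle G 4 T) {a y y' : V}
    (h : s(a, y) ∈ nondegCrossedges T) (h' : s(a, y') ∈ nondegCrossedges T) : y = y' := by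
  by_contra hyy
  obtain ⟨s₁, hs₁, s₂, hs₂, ha₁, ha₂, hy₂, hy₁⟩ := exists_seps_of_mem_nondegCrossedges h
  obtain ⟨s₃, hs₃, s₄, hs₄, ha₃, ha₄, hy₄, hy₃⟩ := exists_seps_of_mem_nondegCrossedges h'
  obtain rfl : s₂ = s₄ := by
    by_contra hne
    exact Set.disjoint_left.1 (hT.disjoint_Y hG hs₂.1 hs₄.1 hne) ha₂ ha₄
  obtain ⟨_, -, -, hE, hu, hZ⟩ := hT.exists_crossedge hG hs₂ hs₁ hy₂ hy₁
  obtain ⟨_, -, -, hE', hu', hZ'⟩ := hT.exists_crossedge hG hs₂ hs₃ hy₄ hy₃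
  have hya : ∀ b ∈ s₂.Y, G.Adj y b → b = a := fun b hb hyb =>
    (hu b hb hyb).trans (hu a ha₂ (adj_of_mem_nondegCrossedges h).symm).symm
  have hya' : ∀ b ∈ s₂.Y, G.Adj y' b → b = a := fun b hb hyb =>
    (hu' b hb hyb).trans (hu' a ha₂ (adj_of_mem_nondegCrossedges h').symm).symm
  obtain ⟨z, hz⟩ := hT.nonempty_Z s₂ hs₂.1.1
  have hS : s₂.S.ncard < 4 := hT.order_lt s₂ hs₂.1.1
  have hc : ((s₂.S \ {y}) \ {y'}).ncard ≤ 1 := by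
    have h1 := Set.ncard_sdiff_singleton_lt_of_mem hy₂ s₂.S.toFinite
    have h2 := Set.ncard_sdiff_singleton_lt_of_mem (show y' ∈ s₂.S \ {y} from ⟨hy₄, Ne.symm hyy⟩)
      (Set.toFinite _)
    omega
  have hY : s₂.Y = {a} := by
    by_contra hYa
    have hB : (s₂.Y \ {a}).Nonempty := by
      by_contra hB
      rw [Set.not_nonempty_iff_eq_empty, Set.sdiff_eq_empty] at hB
      exact hYa (hB.antisymm (by simpa using ha₂))
    have h1 := hG.three_le_ncard (X := insert a ((s₂.S \ {y}) \ {y'})) hB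
      (fun b hb w hw => by
        by_cases hwa : w = a
        · exact Or.inr (Or.inl hwa)
        · refine (s₂.mem_Y_or_S_of_adj hb.1 hw).imp (fun h => ⟨h, hwa⟩) (fun h => Or.inr ?_)
          exact ⟨⟨h, by rintro rfl; exact hb.2 (hya b hb.1 hw.symm)⟩,
            by rintro rfl; exact hb.2 (hya' b hb.1 hw.symm)⟩)
      (fun h => s₂.notMem_Z_of_mem_Y h.1 hz) (z := z) (by
        rintro (rfl | h)
        · exact s₂.notMem_Z_of_mem_Y ha₂ hz
        · exact s₂.notMem_Z_of_mem_S h.1.1 hz)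
    have h2 := Set.ncard_insert_le a ((s₂.S \ {y}) \ {y'})
    omega
  refine hs₂.2 ⟨⟨⟨a, ha₂⟩, ⟨z, hz⟩⟩, by simp [hY], ?_⟩
  have hny : ∀ x ∈ s₂.S, ¬ G.Adj y x := fun x hx hyx =>
    s₁.not_adj y hy₁ x (hZ x hx hyx.ne') hyx
  have hny' : ∀ x ∈ s₂.S, ¬ G.Adj y' x := fun x hx hyx =>
    s₃.not_adj y' hy₃ x (hZ' x hx hyx.ne') hyx
  intro p hp q hq hpq hadj
  refine hpq ((Set.ncard_le_one (Set.toFinite _)).1 hc p ?_ q ?_)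
  · exact ⟨⟨hp, by rintro rfl; exact hny q hq hadj⟩, by rintro rfl; exact hny' q hq hadj⟩
  · exact ⟨⟨hq, by rintro rfl; exact hny p hp hadj.symm⟩,
      by rintro rfl; exact hny' p hp hadj.symm⟩

end Tangle

section TangleRegion

variable {T : Set (Separation G)} {R R' : Set V}

theorem IsTangleRegion.subset_baseRegion (hR : IsTangleRegion T R) : R ⊆ baseRegion T := by
  obtain ⟨d, -, rfl⟩ := hR
  exact Set.sdiff_subset

theorem IsTangleRegion.exists_mate (hR : IsTangleRegion T R) {v : V} (hv : v ∈ baseRegion T)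
    (hvR : v ∉ R) : ∃ w, s(v, w) ∈ nondegCrossedges T := by
  obtain ⟨d, hd, rfl⟩ := hR
  obtain ⟨e, he, rfl⟩ : v ∈ d '' nondegCrossedges T := by
    by_contra h
    exact hvR ⟨hv, h⟩
  obtain ⟨w, hw⟩ := Sym2.mem_iff_exists.1 (hd e he)
  exact ⟨w, hw ▸ he⟩

/-- A vertex outside a region lies in the small side of a non-degenerate minimal separation. -/
theorem IsTangleRegion.exists_mem_Y (hR : IsTangleRegion T R) {v : V} (hvR : v ∉ R) :
    ∃ s ∈ nondegMinimalSeps T, v ∈ s.Y := by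
  by_cases hv : v ∈ baseRegion T
  · obtain ⟨w, hw⟩ := hR.exists_mate hv hvR
    obtain ⟨_, _, t, ht, _, h, _⟩ := exists_seps_of_mem_nondegCrossedges hw
    exact ⟨t, ht, h⟩
  · by_contra! hn
    have hS : ∀ s ∈ nondegMinimalSeps T, v ∉ s.S := fun s hs h =>
      hv (mem_baseRegion_of_mem_S hs h)
    refine hv (Or.inl (Set.mem_iInter₂.2 fun s hs => ?_))
    exact ((s.mem_Y_or_S_or_Z v).resolve_left (hn s hs)).resolve_left (hS s hs)

theorem mem_supp_of_adj {C : (G.induce Rᶜ).ConnectedComponent} {v w : V}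
    (hv : v ∈ Subtype.val '' C.supp) (hw : w ∉ R) (h : G.Adj v w) :
    w ∈ Subtype.val '' C.supp := by
  obtain ⟨v, hv, rfl⟩ := hv
  exact ⟨⟨w, hw⟩, C.mem_supp_of_adj_mem_supp hv h, rfl⟩

theorem notMem_of_mem_supp {C : (G.induce Rᶜ).ConnectedComponent} {v : V}
    (hv : v ∈ Subtype.val '' C.supp) : v ∉ R := by
  obtain ⟨v, hv, rfl⟩ := hv
  exact v.2

theorem setNeighbors_subset {s : Separation G} {C : (G.induce Rᶜ).ConnectedComponent}
    (hC : Subtype.val '' C.supp ⊆ s.Y) :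
    setNeighbors G (Subtype.val '' C.supp) ⊆ (s.Y ∪ s.S) ∩ R := by
  rintro v ⟨hv, a, ha, hav⟩
  refine ⟨s.mem_Y_or_S_of_adj (hC ha) hav, ?_⟩
  by_contra hvR
  exact hv (mem_supp_of_adj ha hvR hav)

open Classical in
/-- The map between two regions of a tangle that exchanges the ends of the crossedges where
necessary. -/
noncomputable def exchange (T : Set (Separation G)) (R' : Set V) (v : V) : V :=
  if h : v ∉ R' ∧ ∃ w, s(v, w) ∈ nondegCrossedges T then h.2.choose else v

theorem exchange_cases (hR : IsTangleRegion T R) (hR' : IsTangleRegion T R') {v : V}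
    (hv : v ∈ R) : v ∈ R' ∧ exchange T R' v = v ∨
      v ∉ R' ∧ s(v, exchange T R' v) ∈ nondegCrossedges T := by
  by_cases h : v ∈ R'
  · exact Or.inl ⟨h, by simp [exchange, h]⟩
  · have hw := hR'.exists_mate (hR.subset_baseRegion hv) h
    refine Or.inr ⟨h, ?_⟩
    rw [exchange, dif_pos ⟨h, hw⟩]
    exact hw.choose_spec

variable [Finite V]

theorem IsTangleRegion.mem_iff_notMem (hG : IsKConnected G 3) (hT : IsTangle G 4 T)
    (hR : IsTangleRegion T R) {v w : V} (h : s(v, w) ∈ nondegCrossedges T) :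
    v ∈ R ↔ w ∉ R := by
  obtain ⟨d, hd, rfl⟩ := hR
  have key : ∀ v w, s(v, w) ∈ nondegCrossedges T →
      (v ∈ baseRegion T \ d '' nondegCrossedges T ↔ d s(v, w) ≠ v) := by
    intro v w h
    obtain ⟨s, hs, _, _, hv, _⟩ := exists_seps_of_mem_nondegCrossedges h
    refine ⟨fun hv he => hv.2 ⟨_, h, he⟩, fun he => ⟨mem_baseRegion_of_mem_S hs hv, ?_⟩⟩
    rintro ⟨e', he', rfl⟩
    obtain ⟨w', hw'⟩ := Sym2.mem_iff_exists.1 (hd e' he')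
    rw [hw'] at he'
    rw [hT.crossedge_unique hG h he', ← hw'] at he
    exact he rfl
  have hne := (adj_of_mem_nondegCrossedges h).ne
  rw [key v w h, key w v (Sym2.eq_swap ▸ h), Sym2.eq_swap (a := w)]
  rcases Sym2.mem_iff.1 (hd _ h) with h | h <;> rw [h] <;> simp [hne, hne.symm]

/-- A vertex of the small side that is not in the region has no neighbors in the separator outside
the region. -/
theorem IsTangleRegion.mem_of_adj (hG : IsKConnected G 3) (hT : IsTangle G 4 T)
    (hR : IsTangleRegion T R) {s : Separation G} (hs : s ∈ nondegMinimalSeps T) {b w : V}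
    (hb : b ∈ s.Y) (hbR : b ∉ R) (hw : w ∈ s.S) (h : G.Adj b w) : w ∈ R := by
  by_contra hwR
  obtain ⟨x, hx⟩ := hR.exists_mate (mem_baseRegion_of_mem_S hs hw) hwR
  obtain ⟨_, _, t, ht, _, hwt, _⟩ := exists_seps_of_mem_nondegCrossedges hx
  obtain ⟨y, -, -, hwy, hu, -⟩ := hT.exists_crossedge hG hs ht hw hwt
  obtain rfl := hu b hb h.symm
  exact hwR ((hR.mem_iff_notMem hG hT hwy).2 hbR)

/-- A vertex of the region in the small side is matched into the separator. -/
theorem IsTangleRegion.exists_mate_of_mem_Y (hG : IsKConnected G 3) (hT : IsTangle G 4 T)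
    (hR : IsTangleRegion T R) {s : Separation G} (hs : s ∈ nondegMinimalSeps T) {y : V}
    (hy : y ∈ s.Y) (hyR : y ∈ R) :
    ∃ a ∈ s.S, s(a, y) ∈ nondegCrossedges T ∧ a ∉ R ∧ ∃ t ∈ nondegMinimalSeps T, a ∈ t.Y ∧
      ∀ x ∈ s.S, x ≠ a → x ∈ t.Z := by
  obtain ⟨t, ht, hyt⟩ : ∃ t ∈ nondegMinimalSeps T, y ∈ t.S := by
    rcases hR.subset_baseRegion hyR with h | h
    · exact absurd (Set.mem_iInter₂.1 h s hs) (s.notMem_Z_of_mem_Y hy)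
    · simpa using h
  obtain ⟨a, ha, hat, hya, -, -⟩ := hT.exists_crossedge hG ht hs hyt hy
  obtain ⟨y', -, -, -, -, hZ⟩ := hT.exists_crossedge hG hs ht ha hat
  exact ⟨a, ha, Sym2.eq_swap ▸ hya, (hR.mem_iff_notMem hG hT hya).1 hyR, t, ht, hat, hZ⟩

/-- The trace of a small side and its separator on a region has at most three vertices. -/
theorem IsTangleRegion.ncard_inter_le (hG : IsKConnected G 3) (hT : IsTangle G 4 T)
    (hR : IsTangleRegion T R) {s : Separation G} (hs : s ∈ nondegMinimalSeps T) :
    ((s.Y ∪ s.S) ∩ R).ncard ≤ 3 := by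
  have h : ∀ v ∈ (s.Y ∪ s.S) ∩ R, ∃ a ∈ s.S,
      (v ∈ s.S ∧ a = v) ∨ (v ∈ s.Y ∧ s(a, v) ∈ nondegCrossedges T ∧ a ∉ R) := by
    rintro v ⟨hv | hv, hvR⟩
    · obtain ⟨a, ha, h, haR, -⟩ := hR.exists_mate_of_mem_Y hG hT hs hv hvR
      exact ⟨a, ha, Or.inr ⟨hv, h, haR⟩⟩
    · exact ⟨v, hv, Or.inl ⟨hv, rfl⟩⟩
  choose! g hgS hg using h
  have hS : s.S.ncard < 4 := hT.order_lt s hs.1.1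
  refine (Set.ncard_le_ncard_of_injOn g hgS (fun v hv w hw hvw => ?_) (Set.toFinite _)).trans
    (Nat.le_of_lt_succ hS)
  rcases hg v hv with ⟨h1, h2⟩ | ⟨h1, h2, h3⟩ <;> rcases hg w hw with ⟨h4, h5⟩ | ⟨h4, h5, h6⟩
  · rw [← h2, ← h5, hvw]
  · rw [← hvw, h2] at h6
    exact absurd hv.2 h6
  · rw [hvw, h5] at h3
    exact absurd hw.2 h3
  · rw [hvw] at h2
    exact hT.crossedge_unique hG h2 h5

theorem IsTangle.three_le_ncard_of_neighbors_subset (hG : IsKConnected G 3) (hT : IsTangle G 4 T)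
    {s : Separation G} (hs : s ∈ T) {B X : Set V} (hB : B.Nonempty) (hBY : B ⊆ s.Y)
    (hX : X ⊆ s.Y ∪ s.S) (h : ∀ b ∈ B, ∀ w, G.Adj b w → w ∈ B ∨ w ∈ X) : 3 ≤ X.ncard := by
  obtain ⟨z, hz⟩ := hT.nonempty_Z s hs
  exact hG.three_le_ncard hB h (fun h => s.notMem_Z_of_mem_Y (hBY h) hz)
    (fun h => (hX h).elim (fun h => s.notMem_Z_of_mem_Y h hz) (fun h => s.notMem_Z_of_mem_S h hz))

theorem IsTangleRegion.supp_subset_Y (hG : IsKConnected G 3) (hT : IsTangle G 4 T)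
    (hR : IsTangleRegion T R) {s : Separation G} (hs : s ∈ nondegMinimalSeps T)
    {C : (G.induce Rᶜ).ConnectedComponent} {c : V} (hc : c ∈ Subtype.val '' C.supp)
    (hcs : c ∈ s.Y) : Subtype.val '' C.supp ⊆ s.Y := by
  obtain ⟨c, hc, rfl⟩ := hc
  rintro _ ⟨v, hv, rfl⟩
  have hr : (G.induce Rᶜ).Reachable c v :=
    SimpleGraph.ConnectedComponent.exact (((SimpleGraph.ConnectedComponent.mem_supp_iff _ _).1 hc).trans
      ((SimpleGraph.ConnectedComponent.mem_supp_iff _ _).1 hv).symm)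
  rw [SimpleGraph.reachable_iff_reflTransGen] at hr
  induction hr with
  | refl => exact hcs
  | @tail b d _ hbd ih =>
    have hb := ih ((C.mem_supp_congr_adj hbd).2 hv)
    exact (s.mem_Y_or_S_of_adj hb hbd).resolve_right fun h =>
      d.2 (hR.mem_of_adj hG hT hs hb b.2 h hbd)

/-- The trace of a small side and its separator on a region is a clique of the torso. -/
theorem IsTangleRegion.torso_adj (hG : IsKConnected G 3) (hT : IsTangle G 4 T)
    (hR : IsTangleRegion T R) {s : Separation G} (hs : s ∈ nondegMinimalSeps T) {p q : R}
    (hp : (p : V) ∈ s.Y ∪ s.S) (hq : (q : V) ∈ s.Y ∪ s.S) (hpq : (p : V) ≠ q) :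
    (torso G R).Adj p q := by
  refine ⟨hpq, ?_⟩
  have hX3 := hR.ncard_inter_le hG hT hs
  by_cases hB : ∃ b ∈ s.Y, b ∉ R
  · obtain ⟨b, hb, hbR⟩ := hB
    let C := (G.induce Rᶜ).connectedComponentMk ⟨b, hbR⟩
    have hbC : b ∈ Subtype.val '' C.supp := ⟨⟨b, hbR⟩, rfl, rfl⟩
    have hCY := hR.supp_subset_Y hG hT hs hbC hb
    have hN := setNeighbors_subset hCY
    have h3 := hT.three_le_ncard_of_neighbors_subset hG hs.1.1 ⟨b, hbC⟩ hCY
      (hN.trans Set.inter_subset_left) (fun b hb w hw => by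
        by_cases h : w ∈ Subtype.val '' C.supp
        · exact Or.inl h
        · exact Or.inr ⟨h, b, hb, hw⟩)
    have hNX := Set.eq_of_subset_of_ncard_le hN (hX3.trans h3) (Set.toFinite _)
    exact Or.inr ⟨C, hNX ▸ ⟨hp, p.2⟩, hNX ▸ ⟨hq, q.2⟩⟩
  · push Not at hB
    left
    have key : ∀ y ∈ s.Y, ∀ x ∈ (s.Y ∪ s.S) ∩ R, x ≠ y → G.Adj y x := by
      intro y hy x hx hxy
      obtain ⟨a, ha, hay, haR, -⟩ := hR.exists_mate_of_mem_Y hG hT hs hy (hB y hy)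
      have hsub : G.neighborSet y ⊆ insert a (((s.Y ∪ s.S) ∩ R) \ {y}) := by
        intro w hw
        rcases s.mem_Y_or_S_of_adj hy hw with h | h
        · exact Or.inr ⟨⟨Or.inl h, hB w h⟩, hw.ne'⟩
        · by_cases hwR : w ∈ R
          · exact Or.inr ⟨⟨Or.inr h, hwR⟩, hw.ne'⟩
          · obtain ⟨u, hu⟩ := hR.exists_mate (mem_baseRegion_of_mem_S hs h) hwR
            obtain ⟨_, _, t, ht, _, hwt, _⟩ := exists_seps_of_mem_nondegCrossedges hu
            obtain ⟨y', -, -, hwy, hun, -⟩ := hT.exists_crossedge hG hs ht h hwt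
            obtain rfl := hun y hy hw.symm
            exact Or.inl (hT.crossedge_unique hG (Sym2.eq_swap ▸ hwy) (Sym2.eq_swap ▸ hay))
      have h3 := hT.three_le_ncard_of_neighbors_subset hG hs.1.1 (Set.singleton_nonempty y)
        (Set.singleton_subset_iff.2 hy) (X := G.neighborSet y)
        (fun w hw => s.mem_Y_or_S_of_adj hy hw) (by rintro _ rfl w hw; exact Or.inr hw)
      have h4 := Set.ncard_insert_le a (((s.Y ∪ s.S) ∩ R) \ {y})
      have h5 := Set.ncard_sdiff_singleton_lt_of_mem
        (show y ∈ (s.Y ∪ s.S) ∩ R from ⟨Or.inl hy, hB y hy⟩) (Set.toFinite _)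
      have h6 := Set.eq_of_subset_of_ncard_le hsub (by omega) (Set.toFinite _)
      have h7 : x ∈ insert a (((s.Y ∪ s.S) ∩ R) \ {y}) := Or.inr ⟨hx, hxy⟩
      rwa [← h6] at h7
    rcases hp with hpY | hpS
    · exact key p hpY q ⟨hq, q.2⟩ hpq.symm
    rcases hq with hqY | hqS
    · exact (key q hqY p ⟨Or.inr hpS, p.2⟩ hpq).symm
    obtain ⟨y, hy⟩ : s.Y.Nonempty := Set.nonempty_iff_ne_empty.2 fun h => by
      have := (hT.eq_of_Y_eq_empty hs.1 hs.1 h).2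
      simp [this] at hpS
    obtain ⟨a, ha, -, haR, t, ht, hat, hZ⟩ := hR.exists_mate_of_mem_Y hG hT hs hy (hB y hy)
    have hpa : (p : V) ≠ a := fun h => haR (h ▸ p.2)
    have hqa : (q : V) ≠ a := fun h => haR (h ▸ q.2)
    have hYc : s.Y = {y} := by
      refine (Set.eq_singleton_iff_unique_mem).2 ⟨hy, fun x hx => ?_⟩
      by_contra hxy
      have hsub : ({x, y, (p : V), (q : V)} : Set V) ⊆ (s.Y ∪ s.S) ∩ R := by
        rintro v (rfl | rfl | rfl | rfl)
        exacts [⟨Or.inl hx, hB _ hx⟩, ⟨Or.inl hy, hB _ hy⟩, ⟨Or.inr hpS, p.2⟩, ⟨Or.inr hqS, q.2⟩]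
      have h1 := Set.ncard_le_ncard hsub (Set.toFinite _)
      have hne : ∀ u ∈ s.Y, ∀ v ∈ s.S, u ≠ v := fun u hu v hv h =>
        s.notMem_S_of_mem_Y hu (h ▸ hv)
      rw [Set.ncard_insert_of_notMem (by
          simp [hxy, hne x hx _ hpS, hne x hx _ hqS]),
        Set.ncard_insert_of_notMem (by simp [hne y hy _ hpS, hne y hy _ hqS]),
        Set.ncard_pair hpq] at h1
      omega
    have hS : s.S = {a, (p : V), (q : V)} := by
      have h1 : s.S.ncard < 4 := hT.order_lt s hs.1.1
      refine (Set.eq_of_subset_of_ncard_le ?_ ?_ (Set.toFinite _)).symm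
      · rintro v (rfl | rfl | rfl)
        exacts [ha, hpS, hqS]
      · rw [Set.ncard_insert_of_notMem (by simp [hpa.symm, hqa.symm]), Set.ncard_pair hpq]
        omega
    have hap := t.not_adj a hat p (hZ p hpS hpa)
    have haq := t.not_adj a hat q (hZ q hqS hqa)
    by_contra hn
    refine hs.2 ⟨⟨⟨y, hy⟩, hT.nonempty_Z s hs.1.1⟩, by simp [hYc], ?_⟩
    rw [hS]
    have hap' := fun h => hap (G.adj_symm h)
    have haq' := fun h => haq (G.adj_symm h)
    have hn' := fun h => hn (G.adj_symm h)
    rintro u (rfl | rfl | rfl) v (rfl | rfl | rfl) huv <;> first | exact absurd rfl huv | assumption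

/-- Any two adjacent vertices of the torso are adjacent in the graph or lie in a common clique
given by a non-degenerate minimal separation. -/
theorem IsTangleRegion.adj_or_exists_of_torso_adj (hG : IsKConnected G 3) (hT : IsTangle G 4 T)
    (hR : IsTangleRegion T R) {p q : R} (h : (torso G R).Adj p q) :
    G.Adj p q ∨ ∃ s ∈ nondegMinimalSeps T, (p : V) ∈ s.Y ∪ s.S ∧ (q : V) ∈ s.Y ∪ s.S := by
  refine h.2.imp_right ?_
  rintro ⟨C, hp, hq⟩
  obtain ⟨-, c, hc, -⟩ := id hp
  obtain ⟨s, hs, hcs⟩ := hR.exists_mem_Y (notMem_of_mem_supp hc)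
  have hN := setNeighbors_subset (hR.supp_subset_Y hG hT hs hc hcs)
  exact ⟨s, hs, (hN hp).1, (hN hq).1⟩

theorem IsTangle.mate_mem (hG : IsKConnected G 3) (hT : IsTangle G 4 T) {s : Separation G}
    (hs : s ∈ nondegMinimalSeps T) {v w : V} (hv : v ∈ s.Y ∪ s.S)
    (h : s(v, w) ∈ nondegCrossedges T) : w ∈ s.Y ∪ s.S := by
  rcases hv with hv | hv
  · exact s.mem_Y_or_S_of_adj hv (adj_of_mem_nondegCrossedges h)
  · obtain ⟨_, _, t, ht, _, hvt, _⟩ := exists_seps_of_mem_nondegCrossedges h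
    obtain ⟨y, -, hy, hvy, -⟩ := hT.exists_crossedge hG hs ht hv hvt
    obtain rfl := hT.crossedge_unique hG h hvy
    exact Or.inl hy

theorem exchange_mem (hG : IsKConnected G 3) (hT : IsTangle G 4 T) (hR : IsTangleRegion T R)
    (hR' : IsTangleRegion T R') {v : V} (hv : v ∈ R) : exchange T R' v ∈ R' := by
  rcases exchange_cases hR hR' hv with ⟨h, h'⟩ | ⟨h, h'⟩
  · rwa [h']
  · by_contra hn
    exact h ((hR'.mem_iff_notMem hG hT h').2 hn)

theorem exchange_exchange (hG : IsKConnected G 3) (hT : IsTangle G 4 T) (hR : IsTangleRegion T R)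
    (hR' : IsTangleRegion T R') {v : V} (hv : v ∈ R) : exchange T R (exchange T R' v) = v := by
  rcases exchange_cases hR hR' hv with ⟨h, h'⟩ | ⟨h, h'⟩
  · rw [h']
    simp [exchange, hv]
  · rcases exchange_cases hR' hR (exchange_mem hG hT hR hR' hv) with ⟨h1, -⟩ | ⟨-, h1⟩
    · exact absurd h1 ((hR.mem_iff_notMem hG hT h').1 hv)
    · exact hT.crossedge_unique hG h1 (Sym2.eq_swap ▸ h')

theorem exchange_mem_sep (hG : IsKConnected G 3) (hT : IsTangle G 4 T) (hR : IsTangleRegion T R)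
    (hR' : IsTangleRegion T R') {s : Separation G} (hs : s ∈ nondegMinimalSeps T) {v : V}
    (hv : v ∈ R) (hvs : v ∈ s.Y ∪ s.S) : exchange T R' v ∈ s.Y ∪ s.S := by
  rcases exchange_cases hR hR' hv with ⟨-, h⟩ | ⟨-, h⟩
  · rwa [h]
  · exact hT.mate_mem hG hs hvs h

theorem torso_adj_exchange (hG : IsKConnected G 3) (hT : IsTangle G 4 T)
    (hR : IsTangleRegion T R) (hR' : IsTangleRegion T R') {p q : R} (h : (torso G R).Adj p q) :
    (torso G R').Adj ⟨exchange T R' p, exchange_mem hG hT hR hR' p.2⟩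
      ⟨exchange T R' q, exchange_mem hG hT hR hR' q.2⟩ := by
  have hne : exchange T R' p ≠ exchange T R' q := fun he => h.1 (by
    rw [← exchange_exchange hG hT hR hR' p.2, he, exchange_exchange hG hT hR hR' q.2])
  have key : ∀ s ∈ nondegMinimalSeps T, (p : V) ∈ s.Y ∪ s.S → (q : V) ∈ s.Y ∪ s.S →
      (torso G R').Adj ⟨exchange T R' p, exchange_mem hG hT hR hR' p.2⟩
        ⟨exchange T R' q, exchange_mem hG hT hR hR' q.2⟩ := fun s hs hp hq =>
    hR'.torso_adj hG hT hs (exchange_mem_sep hG hT hR hR' hs p.2 hp)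
      (exchange_mem_sep hG hT hR hR' hs q.2 hq) hne
  rcases hR.adj_or_exists_of_torso_adj hG hT h with hadj | ⟨s, hs, hp, hq⟩
  · rcases exchange_cases hR hR' p.2 with ⟨-, hp⟩ | ⟨hp, -⟩
    · rcases exchange_cases hR hR' q.2 with ⟨-, hq⟩ | ⟨hq, -⟩
      · refine ⟨hne, Or.inl ?_⟩
        simpa only [hp, hq] using hadj
      · obtain ⟨s, hs, hqs⟩ := hR'.exists_mem_Y hq
        exact key s hs (s.mem_Y_or_S_of_adj hqs hadj.symm) (Or.inl hqs)
    · obtain ⟨s, hs, hps⟩ := hR'.exists_mem_Y hp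
      exact key s hs (Or.inl hps) (s.mem_Y_or_S_of_adj hps hadj)
  · exact key s hs hp hq

/-- The torsos of any two regions of a tangle of order four are isomorphic. -/
noncomputable def torsoIso (hG : IsKConnected G 3) (hT : IsTangle G 4 T)
    (hR : IsTangleRegion T R) (hR' : IsTangleRegion T R') : torso G R ≃g torso G R' where
  toFun p := ⟨exchange T R' p, exchange_mem hG hT hR hR' p.2⟩
  invFun p := ⟨exchange T R p, exchange_mem hG hT hR' hR p.2⟩
  left_inv p := Subtype.ext (exchange_exchange hG hT hR hR' p.2)
  right_inv p := Subtype.ext (exchange_exchange hG hT hR' hR p.2)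
  map_rel_iff' {p q} := by
    refine ⟨fun h => ?_, torso_adj_exchange hG hT hR hR'⟩
    have := torso_adj_exchange hG hT hR' hR h
    simpa only [Equiv.coe_fn_mk, exchange_exchange hG hT hR hR' p.2,
      exchange_exchange hG hT hR hR' q.2, Subtype.coe_eta] using this

end TangleRegion

section Transport

variable {G' : SimpleGraph W}

namespace Separation

theorem map_map_symm (f : G ≃g G') (s : Separation G') : (s.map f.symm).map f = s := by
  ext v <;> simp [map, Set.mem_image]

theorem map_le_map (f : G ≃g G') {s t : Separation G} (h : s ≤ t) : s.map f ≤ t.map f := by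
  change (s.map f).S ∪ (s.map f).Z ⊂ (t.map f).S ∪ (t.map f).Z ∨
    (s.map f).S ∪ (s.map f).Z = (t.map f).S ∪ (t.map f).Z ∧ (s.map f).S ⊆ (t.map f).S
  simp only [map, ← Set.image_union]
  rcases h with h | ⟨h, h'⟩
  · exact Or.inl (f.injective.image_strictMono h)
  · exact Or.inr ⟨congrArg _ h, Set.image_mono h'⟩

theorem degenerate_of_map (f : G ≃g G') {s : Separation G} (h : (s.map f).Degenerate) :
    s.Degenerate := by
  refine ⟨⟨Set.image_nonempty.1 h.1.1, Set.image_nonempty.1 h.1.2⟩,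
    (Set.ncard_image_of_injective _ f.injective).symm.trans h.2.1, fun u hu v hv huv hadj => ?_⟩
  exact h.2.2 (Set.mem_image_of_mem f hu) (Set.mem_image_of_mem f hv)
    (f.injective.ne huv) (f.map_adj_iff.2 hadj)

theorem Cross.map (f : G ≃g G') {s t : Separation G} (h : s.Cross t) :
    (s.map f).Cross (t.map f) := by
  refine fun ho => h ?_
  simp only [Orthogonal, Separation.map, ← Set.image_union, ← Set.image_inter f.injective] at ho
  exact (Set.image_subset_image_iff f.injective).1 ho

end Separation

/-- The isomorphism `f` maps the separations in `T` exactly to those in `T'`. -/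
def MapsTangle (f : G ≃g G') (T : Set (Separation G)) (T' : Set (Separation G')) : Prop :=
  ∀ s, s ∈ T ↔ s.map f ∈ T'

variable {f : G ≃g G'} {T : Set (Separation G)} {T' : Set (Separation G')}

theorem MapsTangle.symm (h : MapsTangle f T T') : MapsTangle f.symm T' T := fun s => by
  rw [h, Separation.map_map_symm]

theorem MapsTangle.map_mem_nondegMinimalSeps (h : MapsTangle f T T') {s : Separation G}
    (hs : s ∈ nondegMinimalSeps T) : s.map f ∈ nondegMinimalSeps T' := by
  refine ⟨⟨(h s).1 hs.1.1, fun t ht hle => ?_⟩, fun hd => hs.2 (Separation.degenerate_of_map f hd)⟩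
  have h1 := Separation.map_le_map f.symm hle
  have h2 : (s.map f).map f.symm = s := Separation.map_map_symm f.symm s
  rw [h2] at h1
  have h3 := Separation.map_le_map f (hs.1.2 ((h.symm t).1 ht) h1)
  rwa [Separation.map_map_symm] at h3

theorem MapsTangle.map_mem_nondegCrossedges (h : MapsTangle f T T') {e : Sym2 V}
    (he : e ∈ nondegCrossedges T) : e.map f ∈ nondegCrossedges T' := by
  obtain ⟨s, hs, t, ht, hc, hE, v, w, rfl, hv, hw⟩ := he
  refine ⟨_, h.map_mem_nondegMinimalSeps hs, _, h.map_mem_nondegMinimalSeps ht, hc.map f,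
    f.map_adj_iff.2 hE, f v, f w, rfl, ?_, ?_⟩
  · simp only [Separation.map, ← Set.image_inter f.injective, hv, Set.image_singleton]
  · simp only [Separation.map, ← Set.image_inter f.injective, hw, Set.image_singleton]

theorem MapsTangle.map_mem_baseRegion (h : MapsTangle f T T') {v : V} (hv : v ∈ baseRegion T) :
    f v ∈ baseRegion T' := by
  rcases hv with hv | hv
  · refine Or.inl (Set.mem_iInter₂.2 fun s hs => ?_)
    have h1 := Set.mem_iInter₂.1 hv _ (h.symm.map_mem_nondegMinimalSeps hs)
    rw [← Separation.map_map_symm f s]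
    exact Set.mem_image_of_mem f h1
  · obtain ⟨s, hs, hvs⟩ := Set.mem_iUnion₂.1 hv
    exact mem_baseRegion_of_mem_S (h.map_mem_nondegMinimalSeps hs) (Set.mem_image_of_mem f hvs)

theorem MapsTangle.image_isTangleRegion (h : MapsTangle f T T') {R : Set V}
    (hR : IsTangleRegion T R) : IsTangleRegion T' (f '' R) := by
  obtain ⟨d, hd, rfl⟩ := hR
  have hff : ∀ e : Sym2 W, (e.map f.symm).map f = e := fun e => by
    induction e with | _ a b => simp
  have hff' : ∀ e : Sym2 V, (e.map f).map f.symm = e := fun e => by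
    induction e with | _ a b => simp
  refine ⟨fun e => f (d (e.map f.symm)), fun e he => ?_, ?_⟩
  · have := hd _ (h.symm.map_mem_nondegCrossedges he)
    rw [← hff e]
    exact Sym2.mem_map.2 ⟨_, by rwa [hff e], rfl⟩
  · rw [Set.image_sdiff f.injective]
    congr 1
    · refine Set.Subset.antisymm (Set.image_subset_iff.2 fun v hv => h.map_mem_baseRegion hv)
        fun v hv => ⟨f.symm v, h.symm.map_mem_baseRegion hv, f.apply_symm_apply v⟩
    · ext v
      constructor
      · rintro ⟨_, ⟨e, he, rfl⟩, rfl⟩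
        exact ⟨_, h.map_mem_nondegCrossedges he, by simp only [hff']⟩
      · rintro ⟨e, he, rfl⟩
        exact ⟨_, ⟨_, h.symm.map_mem_nondegCrossedges he, rfl⟩, rfl⟩

theorem torso_adj_image (f : G ≃g G') {R : Set V} {R' : Set W} (hR : ∀ v, v ∈ R ↔ f v ∈ R')
    {p q : R} (h : (torso G R).Adj p q) :
    (torso G' R').Adj ⟨f p, (hR p).1 p.2⟩ ⟨f q, (hR q).1 q.2⟩ := by
  refine ⟨f.injective.ne h.1, h.2.imp f.map_adj_iff.2 ?_⟩
  rintro ⟨C, hp, hq⟩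
  let g : G.induce Rᶜ →g G'.induce R'ᶜ :=
    { toFun := fun v => ⟨f v, fun hv => v.2 ((hR v).2 hv)⟩
      map_rel' := fun {_ _} h => f.map_adj_iff.2 h }
  have key : ∀ v ∈ R, v ∈ setNeighbors G (Subtype.val '' C.supp) →
      f v ∈ setNeighbors G' (Subtype.val '' (C.map g).supp) := by
    rintro v hv ⟨-, _, ⟨a, ha, rfl⟩, hav⟩
    refine ⟨fun h => notMem_of_mem_supp h ((hR v).1 hv), f a, ⟨g a, ?_, rfl⟩,
      f.map_adj_iff.2 hav⟩
    rw [SimpleGraph.ConnectedComponent.mem_supp_iff] at ha ⊢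
    rw [← ha]
    rfl
  exact ⟨C.map g, key p p.2 hp, key q q.2 hq⟩

/-- A graph isomorphism induces an isomorphism of torsos. -/
def torsoImageIso (f : G ≃g G') {R : Set V} {R' : Set W} (hR : ∀ v, v ∈ R ↔ f v ∈ R') :
    torso G R ≃g torso G' R' where
  toEquiv := f.toEquiv.subtypeEquiv hR
  map_rel_iff' {p q} := by
    refine ⟨fun h => ?_, torso_adj_image f hR⟩
    have hR' : ∀ v, v ∈ R' ↔ f.symm v ∈ R := fun v => by rw [hR, f.apply_symm_apply]
    have := torso_adj_image f.symm hR' h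
    simpa using this

end Transport

end QuasiFour

theorem mainTheorem6 {V V' : Type*} [Finite V] [Finite V']
    (G : SimpleGraph V) (G' : SimpleGraph V')
    (hG : QuasiFour.IsKConnected G 3) (hG' : QuasiFour.IsKConnected G' 3)
    (T : Set (QuasiFour.Separation G)) (T' : Set (QuasiFour.Separation G'))
    (hT : QuasiFour.IsTangle G 4 T) (hT' : QuasiFour.IsTangle G' 4 T')
    (f : G ≃g G')
    (hf : ∀ s : QuasiFour.Separation G, s.order < 4 → (s ∈ T ↔ s.map f ∈ T'))
    (R : Set V) (R' : Set V')
    (hR : QuasiFour.IsTangleRegion T R) (hR' : QuasiFour.IsTangleRegion T' R') :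
    Nonempty (QuasiFour.torso G R ≃g QuasiFour.torso G' R') := by
  have h : QuasiFour.MapsTangle f T T' := fun s => by
    have ho : (s.map f).order = s.order := Set.ncard_image_of_injective _ f.injective
    exact ⟨fun hs => (hf s (hT.order_lt s hs)).1 hs,
      fun hs => (hf s (ho ▸ hT'.order_lt _ hs)).2 hs⟩
  exact ⟨(QuasiFour.torsoImageIso f fun _ => f.injective.mem_set_image.symm).trans
    (QuasiFour.torsoIso hG' hT' (h.image_isTangleRegion hR) hR')⟩
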